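/- Let $v$ be a positive integer. A partial Steiner triple system of order $v$, PSTS$(v)$, is a pair $(X,\mathcal B)$ where $X$ is a set of $v$ points and $\mathcal B$ is a set of 3-subsets of $X$, called blocks, such that every pair of distinct points occurs in at most one block; it is a Steiner triple system, STS$(v)$, if every pair of distinct points occurs in exactly one block. A partial parallel class is a set of pairwise disjoint blocks, and its size is the number of its blocks. The maximum partial parallel class of a PSTS$(v)$ is said to have size $\rho$ if there is a partial parallel class of size $\rho$ and none of size $\rho+1$. For $0 \le \rho \le v/3$, let $\beta(\rho,v)$ denote the maximum number of blocks in any PSTS$(v)$ in which the maximum partial parallel class has size $\rho$. **Theorem.** For all $v \equiv 1,3 \pmod 6$ with $v \neq 7$, $$\beta\left(\left\lfloor \tfrac{v}{3} \right\rfloor, v\right) = \frac{v(v-1)}{6},$$ and there is an STS$(v)$ that has a partial parallel class of size $\lfloor v/3 \rfloor$. Also, $\beta(2,7) = 5$. -/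

import Mathlib

/-- A partial Steiner triple system on the point set `X`: a set of 3-subsets of `X` (blocks) such
that every pair of distinct points occurs in at most one block. -/
structure PartialSTS (X : Type*) where
  blocks : Finset (Finset X)
  card_block : ∀ B ∈ blocks, B.card = 3
  pair_unique : ∀ x y : X, x ≠ y → ∀ B ∈ blocks, ∀ C ∈ blocks,
    x ∈ B → y ∈ B → x ∈ C → y ∈ C → B = C

namespace PartialSTS

variable {X : Type*}

/-- A Steiner triple system: every pair of distinct points occurs in exactly one block. -/
def IsSTS (S : PartialSTS X) : Prop :=
  ∀ x y : X, x ≠ y → ∃! B : Finset X, B ∈ S.blocks ∧ x ∈ B ∧ y ∈ B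

/-- A partial parallel class: a set of pairwise disjoint blocks. -/
def IsPPC (S : PartialSTS X) (P : Finset (Finset X)) : Prop :=
  P ⊆ S.blocks ∧ ∀ B ∈ P, ∀ C ∈ P, B ≠ C → Disjoint B C

/-- The maximum partial parallel class of `S` has size `ρ`: there is a partial parallel class of
size `ρ`, and none of size `ρ + 1`. -/
def MaxPPCSize (S : PartialSTS X) (ρ : ℕ) : Prop :=
  (∃ P, S.IsPPC P ∧ P.card = ρ) ∧ ¬ ∃ P, S.IsPPC P ∧ P.card = ρ + 1

/-- The numbers of blocks of the partial Steiner triple systems on `v` points in which the maximum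
partial parallel class has size `ρ`. -/
def blockCounts (ρ v : ℕ) : Set ℕ :=
  {b | ∃ S : PartialSTS (Fin v), S.MaxPPCSize ρ ∧ S.blocks.card = b}

/-- `beta ρ v` is the maximum number of blocks in a partial Steiner triple system on `v` points in
which the maximum partial parallel class has size `ρ`. -/
noncomputable def beta (ρ v : ℕ) : ℕ := sSup (blockCounts ρ v)

theorem bddAbove_blockCounts (ρ v : ℕ) : BddAbove (blockCounts ρ v) := by
  refine ⟨Fintype.card (Finset (Fin v)), ?_⟩
  rintro b ⟨S, -, rfl⟩
  exact Finset.card_le_univ _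

/-- The supremum defining `beta` is a genuine maximum whenever a system as required exists. -/
theorem isGreatest_beta {ρ v : ℕ} (h : (blockCounts ρ v).Nonempty) :
    IsGreatest (blockCounts ρ v) (beta ρ v) :=
  ⟨Nat.sSup_mem h (bddAbove_blockCounts ρ v), fun _ hb => le_csSup (bddAbove_blockCounts ρ v) hb⟩

end PartialSTS

/-! Counting ordered pairs of points gives at most v(v-1)/6 blocks, with equality for an STS, and at
most v/3 triples can be disjoint. So for v ≠ 7 it suffices to find an STS(v) with ⌊v/3⌋ disjoint
blocks. For v = 6t+3 the vertical blocks of the Bose construction partition the points. For v = 6t+1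
the Skolem construction has only t vertical blocks, while 2t disjoint blocks are needed. Three
columns x, y, f x y are covered by three mixed blocks, one per level, so it is enough to split the
2t columns into members of A and such triples. Taking f x y = π (x + y), a suitable permutation π
comes from `exists_perm_comp_eq`. For v = 7, two disjoint blocks force every other block through the
remaining point. -/

open Finset

namespace PartialSTS

/-! ### Counting pairs -/

/-- Double counting of the pairs of points in a family of triples. -/
theorem sum_card_filter_pair {X : Type*} [Fintype X] [DecidableEq X] (F : Finset (Finset X))
    (h3 : ∀ B ∈ F, B.card = 3) :
    ∑ p ∈ (univ : Finset X).offDiag, (F.filter fun B => p.1 ∈ B ∧ p.2 ∈ B).card = 6 * F.card := by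
  have h := sum_card_bipartiteAbove_eq_sum_card_bipartiteBelow
    (s := (univ : Finset X).offDiag) (t := F) (fun p B => p.1 ∈ B ∧ p.2 ∈ B)
  simp only [bipartiteAbove, bipartiteBelow] at h
  rw [h, sum_congr rfl (g := fun _ => 6), sum_const, smul_eq_mul, mul_comm]
  intro B hB
  have : (univ : Finset X).offDiag.filter (fun p => p.1 ∈ B ∧ p.2 ∈ B) = B.offDiag := by
    ext p; simp only [mem_filter, mem_offDiag, mem_univ]; tauto
  rw [this, offDiag_card, h3 B hB]

theorem card_offDiag_univ_fin (v : ℕ) : (univ : Finset (Fin v)).offDiag.card = v * (v - 1) := by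
  rw [offDiag_card, card_univ, Fintype.card_fin, Nat.mul_sub, mul_one]

theorem six_mul_card_blocks_le {v : ℕ} (S : PartialSTS (Fin v)) :
    6 * S.blocks.card ≤ v * (v - 1) := by
  rw [← sum_card_filter_pair S.blocks S.card_block, ← card_offDiag_univ_fin v, card_eq_sum_ones]
  refine sum_le_sum fun p hp => card_le_one.2 fun B hB C hC => ?_
  simp only [mem_filter, mem_offDiag] at hB hC hp
  exact S.pair_unique p.1 p.2 hp.2.2 B hB.1 C hC.1 hB.2.1 hB.2.2 hC.2.1 hC.2.2

theorem IsSTS.six_mul_card_blocks {v : ℕ} {S : PartialSTS (Fin v)} (hS : S.IsSTS) :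
    6 * S.blocks.card = v * (v - 1) := by
  refine S.six_mul_card_blocks_le.antisymm ?_
  rw [← sum_card_filter_pair S.blocks S.card_block, ← card_offDiag_univ_fin v, card_eq_sum_ones]
  refine sum_le_sum fun p hp => card_pos.2 ?_
  obtain ⟨B, hB, -⟩ := hS p.1 p.2 (mem_offDiag.1 hp).2.2
  exact ⟨B, mem_filter.2 hB⟩

/-- A covering family with at most `v (v - 1) / 6` triples is a Steiner triple system. -/
theorem exists_isSTS_of_cover {v : ℕ} (F : Finset (Finset (Fin v))) (h3 : ∀ B ∈ F, B.card = 3)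
    (hcov : ∀ x y, x ≠ y → ∃ B ∈ F, x ∈ B ∧ y ∈ B) (hcard : 6 * F.card ≤ v * (v - 1)) :
    ∃ S : PartialSTS (Fin v), S.blocks = F ∧ S.IsSTS := by
  have hle : ∀ p ∈ (univ : Finset (Fin v)).offDiag,
      1 ≤ (F.filter fun B => p.1 ∈ B ∧ p.2 ∈ B).card := by
    intro p hp
    obtain ⟨B, hB, h⟩ := hcov p.1 p.2 (mem_offDiag.1 hp).2.2
    exact card_pos.2 ⟨B, mem_filter.2 ⟨hB, h⟩⟩
  -- Every pair is covered at least once and the average is at most one, so each is covered exactly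
  -- once.
  have hsum : ∑ _p ∈ (univ : Finset (Fin v)).offDiag, 1 =
      ∑ p ∈ (univ : Finset (Fin v)).offDiag, (F.filter fun B => p.1 ∈ B ∧ p.2 ∈ B).card := by
    refine (sum_le_sum hle).antisymm ?_
    rwa [sum_card_filter_pair F h3, ← card_eq_sum_ones, card_offDiag_univ_fin]
  have hone := (sum_eq_sum_iff_of_le hle).1 hsum
  have huniq : ∀ x y : Fin v, x ≠ y → ∀ B ∈ F, ∀ C ∈ F,
      x ∈ B → y ∈ B → x ∈ C → y ∈ C → B = C := by
    intro x y hxy B hB C hC h1 h2 h3 h4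
    have := (hone (x, y) (by simp [hxy])).ge
    exact card_le_one.1 this B (by simp [hB, h1, h2]) C (by simp [hC, h3, h4])
  refine ⟨⟨F, h3, huniq⟩, rfl, fun x y hxy => ?_⟩
  obtain ⟨B, hB, h1, h2⟩ := hcov x y hxy
  exact ⟨B, ⟨hB, h1, h2⟩, fun C hC => huniq x y hxy C hC.1 B hB hC.2.1 hC.2.2 h1 h2⟩

/-- A Steiner triple system on `Fin v` from an indexed covering family of triples on any type with
`v` points, together with the partial parallel class given by a disjoint subfamily. -/
theorem exists_isSTS_isPPC_of_family {v : ℕ} {X I J : Type*} [Fintype X] [Fintype I] [Fintype J]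
    (hX : Fintype.card X = v) (blk : I → Finset X) (h3 : ∀ i, (blk i).card = 3)
    (hcov : ∀ x y, x ≠ y → ∃ i, x ∈ blk i ∧ y ∈ blk i)
    (hcard : 6 * Fintype.card I ≤ v * (v - 1)) (sel : J → I)
    (hsel : ∀ j j' x, x ∈ blk (sel j) → x ∈ blk (sel j') → j = j') :
    ∃ S : PartialSTS (Fin v), S.IsSTS ∧ ∃ P, S.IsPPC P ∧ P.card = Fintype.card J := by
  classical
  let e : X ≃ Fin v := Fintype.equivFinOfCardEq hX
  let b : I → Finset (Fin v) := fun i => (blk i).map e.toEmbedding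
  have hb : ∀ i x, x ∈ b i ↔ e.symm x ∈ blk i := fun i x => mem_map_equiv
  obtain ⟨S, hS, hSTS⟩ := exists_isSTS_of_cover (univ.image b)
    (by simp [b, h3])
    (by
      intro x y hxy
      obtain ⟨i, hi⟩ := hcov (e.symm x) (e.symm y) (by simpa using hxy)
      exact ⟨b i, mem_image_of_mem _ (mem_univ _), (hb i x).2 hi.1, (hb i y).2 hi.2⟩)
    -- Indices need not be known to give distinct blocks: an upper bound suffices.
    ((Nat.mul_le_mul_left 6 card_image_le).trans hcard)
  have hdis : ∀ j j' x, x ∈ b (sel j) → x ∈ b (sel j') → j = j' := fun j j' x h h' =>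
    hsel j j' _ ((hb _ _).1 h) ((hb _ _).1 h')
  refine ⟨S, hSTS, univ.image fun j => b (sel j), ⟨?_, ?_⟩, ?_⟩
  · rw [hS]
    intro B hB
    obtain ⟨j, -, rfl⟩ := mem_image.1 hB
    exact mem_image_of_mem _ (mem_univ _)
  · intro B hB C hC hne
    obtain ⟨j, -, rfl⟩ := mem_image.1 hB
    obtain ⟨j', -, rfl⟩ := mem_image.1 hC
    refine disjoint_left.2 fun x hx hx' => hne ?_
    rw [hdis j j' x hx hx']
  · rw [card_image_of_injective, card_univ]
    intro j j' h
    obtain ⟨x, hx⟩ : (b (sel j)).Nonempty := card_pos.1 (by simp [b, h3])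
    exact hdis j j' x hx (by simpa only [h] using hx)

/-! ### The Bose and Skolem constructions -/

section TripleConstructions

variable {Q : Type*} [DecidableEq Q]

/-- The block `{(x, c), (y, c), (f x y, c + 1)}` of the Bose and Skolem constructions. -/
def mixedBlock (f : Q → Q → Q) (hf : ∀ x y, f x y = f y x) (c : ZMod 3) (s : Sym2 Q) :
    Finset (Q × ZMod 3) :=
  Sym2.lift ⟨fun x y => {(x, c), (y, c), (f x y, c + 1)}, fun x y => by
    simp only [hf x y, insert_comm]⟩ s

/-- The block `{x} × ZMod 3` of the Bose and Skolem constructions. -/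
def verticalBlock (x : Q) : Finset (Q × ZMod 3) := {(x, 0), (x, 1), (x, 2)}

variable {f : Q → Q → Q} {hf : ∀ x y, f x y = f y x}

@[simp] theorem mem_mixedBlock {c : ZMod 3} {x y : Q} {p : Q × ZMod 3} :
    p ∈ mixedBlock f hf c s(x, y) ↔ p = (x, c) ∨ p = (y, c) ∨ p = (f x y, c + 1) := by
  simp [mixedBlock]

@[simp] theorem mem_verticalBlock {x : Q} {p : Q × ZMod 3} :
    p ∈ verticalBlock x ↔ p.1 = x := by
  obtain ⟨y, c⟩ := p
  have : c = 0 ∨ c = 1 ∨ c = 2 := by revert c; decide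
  simp only [verticalBlock, mem_insert, mem_singleton, Prod.mk.injEq]
  tauto

theorem card_verticalBlock (x : Q) : (verticalBlock x).card = 3 :=
  card_eq_three.2 ⟨(x, 0), (x, 1), (x, 2), by simp, by
    simp only [ne_eq, Prod.mk.injEq, true_and]; decide, by
    simp only [ne_eq, Prod.mk.injEq, true_and]; decide, rfl⟩

theorem card_mixedBlock (c : ZMod 3) {s : Sym2 Q} (hs : ¬ s.IsDiag) :
    (mixedBlock f hf c s).card = 3 := by
  induction s with
  | h x y =>
    have hxy : x ≠ y := by simpa using hs
    exact card_eq_three.2 ⟨(x, c), (y, c), (f x y, c + 1), by simp [hxy], by simp, by simp, rfl⟩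

theorem six_mul_card_mixed_index [Fintype Q] :
    6 * Fintype.card ({s : Sym2 Q // ¬ s.IsDiag} × ZMod 3) =
      9 * (Fintype.card Q * (Fintype.card Q - 1)) := by
  rw [Fintype.card_prod, Sym2.card_subtype_not_diag, ZMod.card]
  have h := Nat.choose_two_right (Fintype.card Q)
  have h2 := Nat.div_mul_cancel (Nat.even_mul_pred_self (Fintype.card Q)).two_dvd
  omega

/-- Two points on different levels are on consecutive levels. -/
theorem zmod_three_consecutive {c d : ZMod 3} (h : c ≠ d) : d = c + 1 ∨ c = d + 1 := by
  revert c d; decide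

/-- The Bose construction. -/
theorem exists_isSTS_isPPC_bose [Fintype Q] (hf : ∀ x y, f x y = f y x) (hid : ∀ x, f x x = x)
    (hsurj : ∀ x, Function.Surjective (f x)) {v : ℕ} (hv : 3 * Fintype.card Q = v) :
    ∃ S : PartialSTS (Fin v), S.IsSTS ∧ ∃ P, S.IsPPC P ∧ P.card = Fintype.card Q := by
  refine exists_isSTS_isPPC_of_family (X := Q × ZMod 3)
    (I := Q ⊕ ({s : Sym2 Q // ¬ s.IsDiag} × ZMod 3)) (J := Q)
    (by rw [Fintype.card_prod, ZMod.card, ← hv, mul_comm])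
    (Sum.elim verticalBlock fun s => mixedBlock f hf s.2 s.1) ?_ ?_ ?_ Sum.inl ?_
  · rintro (x | s)
    · exact card_verticalBlock x
    · exact card_mixedBlock (hf := hf) _ s.1.2
  · have key : ∀ x y c, ∃ i : Q ⊕ ({s : Sym2 Q // ¬ s.IsDiag} × ZMod 3),
        (x, c) ∈ Sum.elim verticalBlock (fun s => mixedBlock f hf s.2 s.1.1) i ∧
        (y, c + 1) ∈ Sum.elim verticalBlock (fun s => mixedBlock f hf s.2 s.1.1) i := by
      intro x y c
      -- Solve `f x z = y`; if `z = x`, idempotence puts both points in one column.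
      obtain ⟨z, rfl⟩ := hsurj x y
      by_cases hz : x = z
      · exact ⟨.inl x, by simp, by simp [← hz, hid]⟩
      · exact ⟨.inr (⟨s(x, z), by simpa using hz⟩, c), by simp, by simp⟩
    rintro ⟨x, c⟩ ⟨y, d⟩ hne
    by_cases hcd : c = d
    · subst hcd
      exact ⟨.inr (⟨s(x, y), by simpa using hne⟩, c), by simp, by simp⟩
    · rcases zmod_three_consecutive hcd with rfl | rfl
      · exact key x y c
      · exact (key y x d).imp fun _ h => h.symm
  · rw [Fintype.card_sum, mul_add, six_mul_card_mixed_index, ← hv]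
    rcases Fintype.card Q with _ | n
    · simp
    · have : 3 * (n + 1) - 1 = 3 * n + 2 := by omega
      rw [this, Nat.add_sub_cancel]
      apply le_of_eq; ring
  · intro x y p hx hy
    simp only [Sum.elim_inl, mem_verticalBlock] at hx hy
    exact hx.symm.trans hy

/-- The block `{∞, (x, c), (g x, c + 1)}` of the Skolem construction. -/
def infinityBlock (g : Q → Q) (x : Q) (c : ZMod 3) : Finset (Option (Q × ZMod 3)) :=
  {none, some (x, c), some (g x, c + 1)}

/-- The Skolem construction from a commutative quasigroup that is idempotent on `A`, and whose
squaring map sends the complement of `A` onto `A`. The partial parallel class consists of vertical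
blocks and of full level orbits of mixed blocks. -/
theorem exists_isSTS_isPPC_skolem [Fintype Q] (hf : ∀ x y, f x y = f y x)
    (hsurj : ∀ x, Function.Surjective (f x)) {A : Finset Q} {t v : ℕ}
    (hQ : Fintype.card Q = 2 * t) (hA : A.card = t) (hv : 6 * t + 1 = v)
    (hid : ∀ x ∈ A, f x x = x) (hsq : ∀ y ∈ A, ∃ x, x ∉ A ∧ f x x = y)
    {J K : Type*} [Fintype J] [Fintype K] (a : J → Q) (x y : K → Q) (ha : ∀ j, a j ∈ A)
    (hinj : Function.Injective
      (Sum.elim a (Sum.elim x (Sum.elim y fun k => f (x k) (y k))))) :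
    ∃ S : PartialSTS (Fin v), S.IsSTS ∧
      ∃ P, S.IsPPC P ∧ P.card = Fintype.card J + Fintype.card K * 3 := by
  have hxy : ∀ k, x k ≠ y k := fun k h => by
    simpa using @hinj (.inr (.inl k)) (.inr (.inr (.inl k))) h
  let I := A ⊕ (({x // x ∉ A} × ZMod 3) ⊕ ({s : Sym2 Q // ¬ s.IsDiag} × ZMod 3))
  let blk : I → Finset (Option (Q × ZMod 3)) :=
    Sum.elim (fun x => (verticalBlock x.1).map .some)
      (Sum.elim (fun p => infinityBlock (fun x => f x x) p.1 p.2)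
        (fun s => (mixedBlock f hf s.2 s.1.1).map .some))
  have hcard : Fintype.card J + Fintype.card K * 3 = Fintype.card (J ⊕ K × ZMod 3) := by
    rw [Fintype.card_sum, Fintype.card_prod, ZMod.card]
  rw [hcard]
  refine exists_isSTS_isPPC_of_family (X := Option (Q × ZMod 3))
    (J := J ⊕ K × ZMod 3) (by rw [Fintype.card_option, Fintype.card_prod, ZMod.card, hQ]; omega)
    blk ?_ ?_ ?_
    (Sum.map (fun j => ⟨a j, ha j⟩)
      fun k => .inr (⟨s(x k.1, y k.1), by simpa using hxy k.1⟩, k.2)) ?_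
  · rintro (x | p | s)
    · simpa [blk] using card_verticalBlock x.1
    · exact card_eq_three.2 ⟨_, _, _, by simp, by simp, by simp, rfl⟩
    · simpa [blk] using card_mixedBlock (hf := hf) _ s.1.2
  · have hinf : ∀ y c, ∃ i, none ∈ blk i ∧ some (y, c) ∈ blk i := by
      intro y c
      -- A column in A is the square of one outside A, so ∞ reaches it from one level below.
      by_cases hy : y ∈ A
      · obtain ⟨x, hx, rfl⟩ := hsq y hy
        exact ⟨.inr (.inl (⟨x, hx⟩, c - 1)), by simp [blk, infinityBlock],
          by simp [blk, infinityBlock]⟩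
      · exact ⟨.inr (.inl (⟨y, hy⟩, c)), by simp [blk, infinityBlock],
          by simp [blk, infinityBlock]⟩
    have key : ∀ x y c, ∃ i, some (x, c) ∈ blk i ∧ some (y, c + 1) ∈ blk i := by
      intro x y c
      obtain ⟨z, rfl⟩ := hsurj x y
      by_cases hz : x = z
      · subst hz
        by_cases hx : x ∈ A
        · exact ⟨.inl ⟨x, hx⟩, by simp [blk], by simp [blk, hid x hx]⟩
        · exact ⟨.inr (.inl (⟨x, hx⟩, c)), by simp [blk, infinityBlock],
            by simp [blk, infinityBlock]⟩
      · exact ⟨.inr (.inr (⟨s(x, z), by simpa using hz⟩, c)), by simp [blk], by simp [blk]⟩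
    rintro (_ | ⟨x, c⟩) (_ | ⟨y, d⟩) hne
    · exact absurd rfl hne
    · exact hinf y d
    · exact (hinf x c).imp fun _ h => h.symm
    by_cases hcd : c = d
    · subst hcd
      exact ⟨.inr (.inr (⟨s(x, y), by simpa using hne⟩, c)), by simp [blk], by simp [blk]⟩
    · rcases zmod_three_consecutive hcd with rfl | rfl
      · exact key x y c
      · exact (key y x d).imp fun _ h => h.symm
  · have h1 : Fintype.card {x // x ∉ A} = t := by
      rw [Fintype.card_subtype_compl, Fintype.card_coe]; omega
    rw [Fintype.card_sum, Fintype.card_sum, mul_add, mul_add, six_mul_card_mixed_index,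
      Fintype.card_prod, h1, Fintype.card_coe, ZMod.card, hQ, hA, ← hv]
    rcases t with _ | n
    · simp
    · have : 2 * (n + 1) - 1 = 2 * n + 1 := by omega
      rw [this, Nat.add_sub_cancel]
      apply le_of_eq; ring
  -- By `hinj` the column of a common point determines the index and the role in the triple; its
  -- level then determines `c`.
  · have hE : ∀ {u w}, Sum.elim a (Sum.elim x (Sum.elim y fun k => f (x k) (y k))) u =
        Sum.elim a (Sum.elim x (Sum.elim y fun k => f (x k) (y k))) w → u = w := fun h => hinj h
    rintro (j | ⟨k, c⟩) (j' | ⟨k', c'⟩) p hp hp'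
    all_goals
      simp only [blk, Sum.map_inl, Sum.map_inr, Sum.elim_inl, Sum.elim_inr, mem_map,
        mem_verticalBlock, mem_mixedBlock, Function.Embedding.some_apply] at hp hp'
      obtain ⟨⟨q, d⟩, hq, rfl⟩ := hp
      obtain ⟨⟨q', d'⟩, hq', he⟩ := hp'
      obtain ⟨rfl, rfl⟩ := Prod.mk.inj (Option.some.inj he)
      simp only [Prod.mk.injEq] at hq hq'
    · simpa using @hE (.inl j) (.inl j') (hq.symm.trans hq')
    · rcases hq' with h | h | h
      · simpa using @hE (.inl j) (.inr (.inl k')) (hq.symm.trans h.1)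
      · simpa using @hE (.inl j) (.inr (.inr (.inl k'))) (hq.symm.trans h.1)
      · simpa using @hE (.inl j) (.inr (.inr (.inr k'))) (hq.symm.trans h.1)
    · rcases hq with h | h | h
      · simpa using @hE (.inl j') (.inr (.inl k)) (hq'.symm.trans h.1)
      · simpa using @hE (.inl j') (.inr (.inr (.inl k))) (hq'.symm.trans h.1)
      · simpa using @hE (.inl j') (.inr (.inr (.inr k))) (hq'.symm.trans h.1)
    · have hlev : ∀ u w : K ⊕ K ⊕ K, Sum.elim x (Sum.elim y fun k => f (x k) (y k)) u =
          Sum.elim x (Sum.elim y fun k => f (x k) (y k)) w → u = w := fun u w h =>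
        Sum.inr_injective (@hE (.inr u) (.inr w) h)
      rcases hq with h | h | h <;> rcases hq' with h' | h' | h'
      · simpa [← h.2, ← h'.2] using hlev (.inl k) (.inl k') (h.1.symm.trans h'.1)
      · simpa using hlev (.inl k) (.inr (.inl k')) (h.1.symm.trans h'.1)
      · simpa using hlev (.inl k) (.inr (.inr k')) (h.1.symm.trans h'.1)
      · simpa using hlev (.inr (.inl k)) (.inl k') (h.1.symm.trans h'.1)
      · simpa [← h.2, ← h'.2] using hlev (.inr (.inl k)) (.inr (.inl k')) (h.1.symm.trans h'.1)
      · simpa using hlev (.inr (.inl k)) (.inr (.inr k')) (h.1.symm.trans h'.1)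
      · simpa using hlev (.inr (.inr k)) (.inl k') (h.1.symm.trans h'.1)
      · simpa using hlev (.inr (.inr k)) (.inr (.inl k')) (h.1.symm.trans h'.1)
      · have hc : c = c' := add_right_cancel (h.2.symm.trans h'.2)
        simpa [hc] using hlev (.inr (.inr k)) (.inr (.inr k')) (h.1.symm.trans h'.1)

end TripleConstructions

/-! ### Orders congruent to 3 modulo 6 -/

theorem exists_isSTS_isPPC_of_mod_six_eq_three {v : ℕ} (hv : v % 6 = 3) :
    ∃ S : PartialSTS (Fin v), S.IsSTS ∧ ∃ P, S.IsPPC P ∧ P.card = v / 3 := by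
  obtain ⟨t, rfl⟩ : ∃ t, v = 3 * (2 * t + 1) := ⟨v / 6, by omega⟩
  -- `t + 1` is the inverse of 2, so the operation is the average.
  have h2 : ((t : ZMod (2 * t + 1)) + 1) * 2 = 1 := by
    have := ZMod.natCast_self (2 * t + 1)
    push_cast at this
    linear_combination this
  have h := exists_isSTS_isPPC_bose (Q := ZMod (2 * t + 1)) (f := fun x y => (t + 1) * (x + y))
    (fun x y => by rw [add_comm x y]) (fun x => by linear_combination x * h2)
    (fun x y => ⟨2 * y - x, by linear_combination y * h2⟩) (v := 3 * (2 * t + 1))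
    (by rw [ZMod.card])
  rw [ZMod.card] at h
  rwa [Nat.mul_div_cancel_left _ (by norm_num)]

/-! ### Orders congruent to 1 modulo 6 -/

/-- Two injective families in a finite type differ by a permutation. -/
theorem exists_perm_comp_eq {ι α : Type*} [Finite α] {u w : ι → α} (hu : Function.Injective u)
    (hw : Function.Injective w) : ∃ π : Equiv.Perm α, ∀ i, π (u i) = w i := by
  classical
  have := Fintype.ofFinite α
  have := Fintype.ofInjective u hu
  obtain ⟨g, hg⟩ := exists_equiv_extend_of_card_eq (α := α) (t := (univ : Finset α)) rfl
    (s := univ.image u) (f := Function.extend u w id) (subset_univ _) (by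
      intro a ha b hb hab
      simp only [coe_image, coe_univ, Set.image_univ, Set.mem_range] at ha hb
      obtain ⟨i, rfl⟩ := ha
      obtain ⟨j, rfl⟩ := hb
      rw [hu.extend_apply, hu.extend_apply] at hab
      rw [hw hab])
  refine ⟨g.trans (Equiv.subtypeUnivEquiv fun x => mem_univ x), fun i => ?_⟩
  have := hg (u i) (mem_image_of_mem _ (mem_univ _))
  rw [hu.extend_apply] at this
  simpa using this

/-- Bounding the difference also handles column sums that exceed the modulus. -/
theorem natCast_zmod_inj_of_abs_lt {n a b : ℕ} (h : (a : ZMod n) = b)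
    (hab : |(a : ℤ) - b| < n) : a = b := by
  have h1 : (n : ℤ) ∣ (a : ℤ) - b := by
    rw [← ZMod.intCast_zmod_eq_zero_iff_dvd]
    push_cast
    rw [h, sub_self]
  have := Int.eq_zero_of_abs_lt_dvd h1 hab
  omega

theorem natCast_zmod_two_mul_parity {t a b : ℕ} (h : (a : ZMod (2 * t)) = b) :
    a % 2 = b % 2 := by
  rw [ZMod.natCast_eq_natCast_iff] at h
  exact h.of_mul_right t

theorem exists_isSTS_isPPC_of_mod_six_eq_one {v : ℕ} (hv : v % 6 = 1) (h7 : v ≠ 7) :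
    ∃ S : PartialSTS (Fin v), S.IsSTS ∧ ∃ P, S.IsPPC P ∧ P.card = v / 3 := by
  obtain ⟨t, rfl⟩ : ∃ t, v = 6 * t + 1 := ⟨v / 6, by omega⟩
  rcases Nat.eq_zero_or_pos t with rfl | ht
  · exact ⟨⟨∅, by simp, by simp⟩, fun x y h => absurd (Fin.ext (by omega)) h, ∅,
      ⟨Subset.rfl, by simp⟩, rfl⟩
  -- Here m = ⌈t/3⌉. The first b columns are vertical, the next 2m form pairs of neighbours, and the
  -- last m, outside A, receive the products. For t = 1 no such b, m exist, whence v ≠ 7.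
  obtain ⟨b, m, hbm, hbt, htb⟩ : ∃ b m, b + 3 * m = 2 * t ∧ b ≤ t ∧ t ≤ b + 2 :=
    ⟨2 * t - (t + 2) / 3 * 3, (t + 2) / 3, by omega, by omega, by omega⟩
  have : NeZero (2 * t) := ⟨by omega⟩
  let G := ZMod (2 * t)
  have hlt : ∀ {p q : ℕ}, p < 2 * t → q < 2 * t → (p : G) = q → p = q := fun hp hq h =>
    natCast_zmod_inj_of_abs_lt h (by rw [abs_lt]; omega)
  let A : Finset G := univ.image fun j : Fin t => ((j : ℕ) : G)
  -- Idempotence on A fixes π on even residues only; sums of neighbours are odd, so their images can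
  -- be prescribed freely.
  obtain ⟨π, hπ⟩ := exists_perm_comp_eq (α := G)
    (u := Sum.elim (fun j : Fin t => ((2 * j : ℕ) : G))
      (fun i : Fin m => ((b + 2 * i + (b + 2 * i + 1) : ℕ) : G)))
    (w := Sum.elim (fun j : Fin t => ((j : ℕ) : G)) (fun i : Fin m => ((b + 2 * m + i : ℕ) : G)))
    (by
      rintro (i | i) (j | j) h <;> simp only [Sum.elim_inl, Sum.elim_inr] at h
      · have := hlt (by omega) (by omega) h
        congr 1; omega
      · have := natCast_zmod_two_mul_parity h
        omega
      · have := natCast_zmod_two_mul_parity h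
        omega
      · have := natCast_zmod_inj_of_abs_lt h (by rw [abs_lt]; omega)
        congr 1; omega)
    (by
      rintro (i | i) (j | j) h <;> simp only [Sum.elim_inl, Sum.elim_inr] at h <;>
        have := hlt (by omega) (by omega) h
      · congr 1; omega
      · omega
      · omega
      · congr 1; omega)
  have hdbl : ∀ j : Fin t, π (((j : ℕ) : G) + ((j : ℕ) : G)) = ((j : ℕ) : G) := by
    intro j
    rw [← two_mul]
    simpa using hπ (.inl j)
  have htriple : ∀ i : Fin m, π (((b + 2 * i : ℕ) : G) + ((b + 2 * i + 1 : ℕ) : G)) =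
      ((b + 2 * m + i : ℕ) : G) := fun i => by
    rw [← Nat.cast_add]
    exact hπ (.inr i)
  obtain ⟨S, hS, P, hP, hc⟩ := exists_isSTS_isPPC_skolem (Q := G) (f := fun x y => π (x + y))
    (A := A) (t := t) (fun x y => by rw [add_comm])
    (fun x => π.surjective.comp (add_left_surjective x))
    (by rw [ZMod.card]) (by
      rw [card_image_of_injective, card_univ, Fintype.card_fin]
      intro i j h
      exact Fin.ext (hlt (by omega) (by omega) h)) rfl
    (by
      intro x hx
      obtain ⟨j, -, rfl⟩ := mem_image.1 hx
      exact hdbl j)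
    (by
      intro y hy
      obtain ⟨j, -, rfl⟩ := mem_image.1 hy
      -- Adding t leaves the double unchanged modulo 2t.
      refine ⟨((j + t : ℕ) : G), fun h => ?_, ?_⟩
      · obtain ⟨i, -, hi⟩ := mem_image.1 h
        have := hlt (by omega) (by omega) hi
        omega
      · have h0 : (t : G) + t = 0 := by
          have := ZMod.natCast_self (2 * t)
          rw [Nat.cast_mul, Nat.cast_two] at this
          rwa [← two_mul]
        rw [Nat.cast_add, add_add_add_comm, h0, add_zero]
        exact hdbl j)
    (fun j : Fin b => ((j : ℕ) : G)) (fun i : Fin m => ((b + 2 * i : ℕ) : G))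
    (fun i : Fin m => ((b + 2 * i + 1 : ℕ) : G))
    (fun j => mem_image.2 ⟨⟨j, by omega⟩, mem_univ _, rfl⟩)
    (by
      simp only [htriple]
      rintro (i | i | i | i) (j | j | j | j) h <;> simp only [Sum.elim_inl, Sum.elim_inr] at h <;>
        have := hlt (by omega) (by omega) h <;> first | (exfalso; omega) | skip
      all_goals
        have hij : i = j := by omega
        rw [hij])
  refine ⟨S, hS, P, hP, hc.trans ?_⟩
  rw [Fintype.card_fin, Fintype.card_fin]
  omega

/-! ### Size of parallel classes and order seven -/

theorem IsPPC.three_mul_card_le {v : ℕ} {S : PartialSTS (Fin v)} {P : Finset (Finset (Fin v))}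
    (hP : S.IsPPC P) : 3 * P.card ≤ v := by
  have h := card_le_univ (P.biUnion id)
  rw [card_biUnion (t := id) fun B hB C hC => hP.2 B hB C hC,
    sum_congr rfl (f := fun B => (id B).card) (g := fun _ => 3) fun B hB => S.card_block B (hP.1 hB), sum_const, smul_eq_mul,
    Fintype.card_fin] at h
  omega

theorem IsPPC.maxPPCSize {v : ℕ} {S : PartialSTS (Fin v)} {P : Finset (Finset (Fin v))}
    (hP : S.IsPPC P) (hc : P.card = v / 3) : S.MaxPPCSize (v / 3) := by
  refine ⟨⟨P, hP, hc⟩, fun ⟨R, hR, hRc⟩ => ?_⟩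
  have := hR.three_mul_card_le
  omega

/-- A partial triple system on seven points with two disjoint blocks has at most five blocks: all
other blocks pass through the seventh point. -/
theorem card_blocks_le_five (S : PartialSTS (Fin 7)) {B C : Finset (Fin 7)} (hB : B ∈ S.blocks)
    (hC : C ∈ S.blocks) (hBC : Disjoint B C) : S.blocks.card ≤ 5 := by
  have hB3 := S.card_block B hB
  have hC3 := S.card_block C hC
  obtain ⟨p, hp⟩ : ∃ p, (B ∪ C)ᶜ = {p} := by
    rw [← card_eq_one, card_compl, card_union_of_disjoint hBC, hB3, hC3]; rfl
  have hinter : ∀ D ∈ S.blocks, ∀ E ∈ S.blocks, D ≠ E → (D ∩ E).card ≤ 1 := by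
    intro D hD E hE hne
    refine card_le_one.2 fun x hx y hy => by_contra fun hxy => hne ?_
    rw [mem_inter] at hx hy
    exact S.pair_unique x y hxy D hD E hE hx.1 hy.1 hx.2 hy.2
  -- D has at most one point in each of B and C, so its third point is p.
  have hmeet : ∀ D ∈ S.blocks \ {B, C}, p ∈ D ∧ (D ∩ B).Nonempty := by
    intro D hD
    simp only [mem_sdiff, mem_insert, mem_singleton, not_or] at hD
    have h1 := hinter D hD.1 B hB hD.2.1
    have h2 := hinter D hD.1 C hC hD.2.2
    have hD3 := S.card_block D hD.1
    have hsub : D ⊆ (D ∩ B) ∪ ((D ∩ C) ∪ (D ∩ {p})) := by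
      rw [← hp]
      intro x hx
      simp only [mem_union, mem_inter, mem_compl]
      tauto
    have h3 := (card_le_card hsub).trans
      ((card_union_le _ _).trans (Nat.add_le_add_left (card_union_le _ _) _))
    have h4 : (D ∩ {p}).card ≤ 1 := (card_le_card inter_subset_right).trans_eq (card_singleton p)
    refine ⟨?_, card_pos.1 (by omega)⟩
    obtain ⟨x, hx⟩ := card_pos.1 (show 0 < (D ∩ {p}).card by omega)
    rw [mem_inter, mem_singleton] at hx
    exact hx.2 ▸ hx.1
  have hpB : p ∉ B := fun h => by
    have : p ∈ (B ∪ C)ᶜ := hp ▸ mem_singleton_self p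
    exact mem_compl.1 this (mem_union_left _ h)
  -- Blocks through p are separated by their points on B, so at most three remain.
  choose! g hg using fun D hD => (hmeet D hD).2
  have hcard : (S.blocks \ {B, C}).card ≤ B.card := by
    refine card_le_card_of_injOn g (fun D hD => (mem_inter.1 (hg D hD)).2) ?_
    intro D hD E hE hDE
    have h1 := mem_inter.1 (hg D hD)
    have h2 := mem_inter.1 (hg E hE)
    exact S.pair_unique p (g D) (fun h => hpB (h ▸ h1.2)) D (mem_sdiff.1 hD).1 E (mem_sdiff.1 hE).1
      (hmeet D hD).1 h1.1 (hmeet E hE).1 (hDE ▸ h2.1)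
  have h5 := le_card_sdiff ({B, C} : Finset (Finset (Fin 7))) S.blocks
  have h6 : ({B, C} : Finset (Finset (Fin 7))).card ≤ 2 := card_le_two
  omega

set_option maxRecDepth 20000 in
theorem five_mem_blockCounts : 5 ∈ blockCounts 2 7 := by
  let S : PartialSTS (Fin 7) :=
    { blocks := {{0, 1, 2}, {3, 4, 5}, {6, 0, 3}, {6, 1, 4}, {6, 2, 5}}
      card_block := by decide
      pair_unique := by decide }
  have hP : S.IsPPC {{0, 1, 2}, {3, 4, 5}} := by
    unfold IsPPC
    decide
  exact ⟨S, hP.maxPPCSize (by decide), by decide⟩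

theorem isGreatest_blockCounts_two_seven : IsGreatest (blockCounts 2 7) 5 := by
  refine ⟨five_mem_blockCounts, ?_⟩
  rintro _ ⟨S, ⟨⟨P, hP, hc⟩, -⟩, rfl⟩
  obtain ⟨B, C, hne, rfl⟩ := card_eq_two.1 hc
  have hB : B ∈ ({B, C} : Finset (Finset (Fin 7))) := by simp
  have hC : C ∈ ({B, C} : Finset (Finset (Fin 7))) := by simp
  exact S.card_blocks_le_five (hP.1 hB) (hP.1 hC) (hP.2 B hB C hC hne)

theorem exists_isSTS_isPPC {v : ℕ} (hv : v % 6 = 1 ∨ v % 6 = 3) (h7 : v ≠ 7) :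
    ∃ S : PartialSTS (Fin v), S.IsSTS ∧ ∃ P, S.IsPPC P ∧ P.card = v / 3 :=
  hv.elim (fun h => exists_isSTS_isPPC_of_mod_six_eq_one h h7)
    exists_isSTS_isPPC_of_mod_six_eq_three

end PartialSTS

theorem theorem1p2 :
    (∀ v : ℕ, (v % 6 = 1 ∨ v % 6 = 3) → v ≠ 7 →
      IsGreatest (PartialSTS.blockCounts (v / 3) v) (PartialSTS.beta (v / 3) v) ∧
      (PartialSTS.beta (v / 3) v : ℚ) = (v : ℚ) * ((v : ℚ) - 1) / 6 ∧
      ∃ S : PartialSTS (Fin v), S.IsSTS ∧ ∃ P, S.IsPPC P ∧ P.card = v / 3) ∧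
    IsGreatest (PartialSTS.blockCounts 2 7) (PartialSTS.beta 2 7) ∧
    PartialSTS.beta 2 7 = 5 := by
  refine ⟨fun v hv h7 => ?_, PartialSTS.isGreatest_beta ⟨5, PartialSTS.five_mem_blockCounts⟩,
    PartialSTS.isGreatest_blockCounts_two_seven.csSup_eq⟩
  obtain ⟨S, hS, P, hP, hc⟩ := PartialSTS.exists_isSTS_isPPC hv h7
  have hmem : S.blocks.card ∈ PartialSTS.blockCounts (v / 3) v := ⟨S, hP.maxPPCSize hc, rfl⟩
  have hcount := hS.six_mul_card_blocks
  have hgr : IsGreatest (PartialSTS.blockCounts (v / 3) v) S.blocks.card := by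
    refine ⟨hmem, ?_⟩
    rintro _ ⟨T, -, rfl⟩
    have := T.six_mul_card_blocks_le
    omega
  refine ⟨PartialSTS.isGreatest_beta ⟨_, hmem⟩, ?_, S, hS, P, hP, hc⟩
  have hbeta : PartialSTS.beta (v / 3) v = S.blocks.card := hgr.csSup_eq
  have hq : (6 : ℚ) * S.blocks.card = v * ((v : ℚ) - 1) := by
    have h1 : 1 ≤ v := by omega
    rw [← Nat.cast_one, ← Nat.cast_sub h1]
    exact_mod_cast hcount
  rw [hbeta]
  linarith
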